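/- Let $\mathbb{F}$ be $\mathbb{R}$, $\mathbb{C}$, or the division ring $\mathbb{H}$ of quaternions, let $n>1$ be an integer, let $F$ be a subfield of $\mathbb{R}$, and regard $n\times n$ matrices over $\mathbb{F}$ as acting on the left of the right vector space $\mathbb{F}^n$ of column vectors. A right eigenvalue of $A\in M_n(\mathbb{F})$ is a $\lambda\in\mathbb{F}$ with $Ax=x\lambda$ for some nonzero $x\in\mathbb{F}^n$; the spectrum of $A$ is the set of its right eigenvalues. The matrix $A$ is triangularizable if $P^{-1}AP$ is upper triangular for some invertible $P\in M_n(\mathbb{F})$. The multiplicity of a real right eigenvalue $\lambda$ of $A$ is the dimension of $\ker (A-\lambda I)^n$ as a right $\mathbb{F}$-vector space. Let $\mathcal{S}\subseteq M_n(\mathbb{F})$ be a semigroup (a set of matrices closed under multiplication) that is irreducible, i.e. for every nonzero $x\in\mathbb{F}^n$ the orbit $\{Sx : S\in\mathcal{S}\}$ spans the right vector space $\mathbb{F}^n$. Assume that every member of $\mathcal{S}$ is triangularizable and has its spectrum contained in $F$. Suppose that the set consisting of the sums of the right eigenvalues, counted with multiplicity, of the members of $\mathcal{S}$ (one sum for each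 member) has exactly $k$ elements, where $k\in\mathbb{N}$. Then $\mathcal{S}$ has at most $k^{n^2}$ elements, and $k>1$. -/

import Mathlib

open scoped Matrix Quaternion

/-- A matrix `A` over `D`, acting by `x ↦ A x` on the right vector space `Dⁿ` of column vectors.
Right `D`-vector spaces are modules over `Dᵐᵒᵖ`, where `(MulOpposite.op c • x) i = x i * c`. -/
def Matrix.rightLin {D : Type*} [DivisionRing D] {n : ℕ} (A : Matrix (Fin n) (Fin n) D) :
    (Fin n → D) →ₗ[Dᵐᵒᵖ] (Fin n → D) where
  toFun x := A *ᵥ x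
  map_add' x y := A.mulVec_add x y
  map_smul' c x := A.mulVec_smul c x

/-- A family of matrices over `D` is irreducible if, under the multiplicative semigroup it
generates, the orbit of every nonzero column vector spans the right vector space `Dⁿ`. -/
def Matrix.IsIrreducibleFamily {D : Type*} [DivisionRing D] {n : ℕ}
    (𝓕 : Set (Matrix (Fin n) (Fin n) D)) : Prop :=
  ∀ x : Fin n → D, x ≠ 0 →
    Submodule.span Dᵐᵒᵖ {y | ∃ A ∈ Subsemigroup.closure 𝓕, y = A *ᵥ x} = ⊤

/-- `A` is triangularizable if `P⁻¹ A P` is upper triangular for some invertible `P` over `D`. -/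
def Matrix.IsTriangularizable {D : Type*} [DivisionRing D] {n : ℕ}
    (A : Matrix (Fin n) (Fin n) D) : Prop :=
  ∃ P : (Matrix (Fin n) (Fin n) D)ˣ,
    ∀ i j : Fin n, j < i → (P⁻¹.val * A * P.val) i j = 0

/-- The spectrum of `A`: the set of right eigenvalues, i.e. of those `c` in `D` with `A x = x c`
for some nonzero column vector `x`. -/
def Matrix.rightSpectrum {D : Type*} [DivisionRing D] {n : ℕ}
    (A : Matrix (Fin n) (Fin n) D) : Set D :=
  {c | ∃ x : Fin n → D, x ≠ 0 ∧ A *ᵥ x = fun i => x i * c}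

/-- The (algebraic) multiplicity of a real number `r` as an eigenvalue of `A`: the dimension of the
generalized eigenspace `ker (A - r)ⁿ` as a right `D`-vector space. -/
noncomputable def Matrix.realMultiplicity {D : Type*} [DivisionRing D] [Algebra ℝ D] {n : ℕ}
    (A : Matrix (Fin n) (Fin n) D) (r : ℝ) : ℕ :=
  Module.finrank Dᵐᵒᵖ (LinearMap.ker (Matrix.rightLin ((A - r • (1 : Matrix _ _ D)) ^ n)))

/-- The sum, counted with multiplicity, of the real right eigenvalues of `A` (there are finitely
many). For a matrix with real spectrum this is the sum of all of its right eigenvalues. -/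
noncomputable def Matrix.eigenvalueSum {D : Type*} [DivisionRing D] [Algebra ℝ D] {n : ℕ}
    (A : Matrix (Fin n) (Fin n) D) : ℝ :=
  ∑ᶠ r ∈ {r : ℝ | algebraMap ℝ D r ∈ A.rightSpectrum}, (A.realMultiplicity r : ℝ) * r

/-! View `D ^ n` as a real vector space. A triangularizable matrix with real spectrum is killed by a
product of real linear factors, so its real trace is `dim_ℝ D` times its eigenvalue sum
(`Matrix.trace_realEnd_eq`). The trace form is nondegenerate on the real span of `S`
(`Matrix.eq_zero_of_trace_mul_eq_zero`), so finitely many sums force `S` to be finite.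

A finite `S` contains a minimal idempotent `E`. Nonzero elements of `E S E` act invertibly on the
range of `E` with finite order and real spectrum, so they are involutions there and commute. A Schur
argument makes them act as signs, and irreducibility then gives `E` rank one, `E = u c`
(`Matrix.exists_vecMulVec_mem`).

Irreducibility also supplies members `f i`, `B j` of `S` for which `A` is determined by the `n ^ 2`
scalars `c (B j) A (f i) u`. Each is the eigenvalue sum of `f i * E * (B j * A)`, a member of `S`,
hence takes at most `k` values. Since `S` has at least two members, `k > 1`. -/

/-! ### Traces of powers and split polynomials over a field -/

open Polynomial in
-- The Bézout projection onto the part where `f` is invertible is a polynomial in `f` without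
-- constant term, so it has trace zero. In characteristic zero such an idempotent vanishes.
theorem LinearMap.isNilpotent_of_forall_trace_pow_eq_zero {K V : Type*} [Field K] [CharZero K]
    [AddCommGroup V] [Module K V] [FiniteDimensional K V] (f : Module.End K V)
    (h : ∀ m : ℕ, LinearMap.trace K V (f ^ (m + 1)) = 0) : IsNilpotent f := by
  obtain ⟨g, hg, hg0⟩ := exists_eq_pow_rootMultiplicity_mul_and_not_dvd f.charpoly
    f.charpoly_monic.ne_zero 0
  set a := f.charpoly.rootMultiplicity 0
  rw [C_0, sub_zero] at hg hg0
  have hcop : IsCoprime ((X : K[X]) ^ (a + 1)) g :=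
    ((Polynomial.prime_X.coprime_iff_not_dvd).2 hg0).pow_left
  obtain ⟨u, v, huv⟩ := hcop
  have hz : aeval f (X ^ a * g) = 0 := by rw [← hg]; exact f.aeval_self_charpoly
  have htr : ∀ q : K[X], LinearMap.trace K V (aeval f (q * X)) = 0 := by
    intro q
    induction q using Polynomial.induction_on' with
    | add p q hp hq => rw [add_mul, map_add, map_add, hp, hq, add_zero]
    | monomial m c =>
      rw [← C_mul_X_pow_eq_monomial, mul_assoc, ← pow_succ, map_mul, aeval_C, map_pow, aeval_X,
        Algebra.algebraMap_eq_smul_one, smul_mul_assoc, one_mul, map_smul, h, smul_zero]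
  set e := aeval f (u * X ^ (a + 1)) with he
  have hidem : IsIdempotentElem e := by
    have h1 : e * e = e * aeval f (1 - v * g) := by
      rw [← huv, add_sub_cancel_right]
    have h2 : e * aeval f (v * g) = 0 := by
      rw [he, ← map_mul, show u * X ^ (a + 1) * (v * g) = (u * v * X) * (X ^ a * g) by ring,
        map_mul, hz, mul_zero]
    rw [IsIdempotentElem, h1, map_sub, mul_sub, h2, map_one, mul_one, sub_zero]
  have he0 : e = 0 := by
    refine LinearMap.IsIdempotentElem.eq_zero_of_trace_eq_zero hidem ?_
    rw [he, pow_succ, ← mul_assoc]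
    exact htr _
  refine ⟨a + 1, ?_⟩
  have h3 : aeval f ((X : K[X]) ^ (a + 1)) = aeval f (X ^ (a + 1) * (u * X ^ (a + 1)) +
      (v * X) * (X ^ a * g)) := by
    congr 1
    calc (X : K[X]) ^ (a + 1) = X ^ (a + 1) * (u * X ^ (a + 1) + v * g) := by rw [huv, mul_one]
      _ = _ := by ring
  rw [map_add, map_mul _ (X ^ (a + 1)) (u * _), map_mul _ (v * X), hz, ← he, he0] at h3
  simpa using h3

open Polynomial in
-- Every complex root of the characteristic polynomial is an eigenvalue of the complexified matrix,
-- hence a root of the split `p`, hence real.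
theorem Module.End.splits_charpoly_of_aeval_eq_zero {V : Type*}
    [AddCommGroup V] [Module ℝ V] [FiniteDimensional ℝ V] (f : Module.End ℝ V) {p : ℝ[X]}
    (hp : p.Splits) (hp0 : p ≠ 0) (h : aeval f p = 0) : f.charpoly.Splits := by
  let b := Module.Free.chooseBasis ℝ V
  set M := LinearMap.toMatrix b b f with hM
  have hMp : aeval M p = 0 := by
    have := congrArg (LinearMap.toMatrixAlgEquiv b) h
    rw [map_zero, ← Polynomial.aeval_algHom_apply] at this
    exact this
  refine Splits.of_splits_map_of_injective (i := algebraMap ℝ ℂ) (algebraMap ℝ ℂ).injective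
    (IsAlgClosed.splits _) ?_
  intro z hz
  have hz1 : IsRoot (M.map (algebraMap ℝ ℂ)).charpoly z := by
    rw [Matrix.charpoly_map, hM, LinearMap.charpoly_toMatrix]
    exact isRoot_of_mem_roots hz
  have hz2 := Matrix.mem_spectrum_iff_isRoot_charpoly.2 hz1
  have hz3 : eval z (p.map (algebraMap ℝ ℂ)) ∈
      spectrum ℂ (aeval (M.map (algebraMap ℝ ℂ)) (p.map (algebraMap ℝ ℂ))) :=
    spectrum.subset_polynomial_aeval _ _ ⟨z, hz2, rfl⟩
  have hzero : aeval (M.map (algebraMap ℝ ℂ)) (p.map (algebraMap ℝ ℂ)) = 0 := by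
    have := congrArg (fun N => ((Algebra.ofId ℝ ℂ).mapMatrix N)) hMp
    simp only [map_zero, ← Polynomial.aeval_algHom_apply] at this
    rw [aeval_map_algebraMap]
    exact this
  have hroot : eval z (p.map (algebraMap ℝ ℂ)) = 0 := by
    rw [hzero] at hz3
    by_contra hne
    rw [spectrum.mem_iff, sub_zero] at hz3
    exact hz3 ((IsUnit.mk0 _ hne).map _)
  exact hp.mem_range_of_isRoot hp0 hroot

/-! ### Real traces and eigenvalue sums of matrices over `D` -/

namespace Matrix

variable {D : Type*} [DivisionRing D] {n : ℕ}

/-- The action of matrices over `D` on columns, as a representation over `ℝ`. -/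
def realEnd [Algebra ℝ D] : Matrix (Fin n) (Fin n) D →ₐ[ℝ] Module.End ℝ (Fin n → D) where
  toFun A :=
    { toFun := fun x => A *ᵥ x
      map_add' := A.mulVec_add
      map_smul' := fun r x => A.mulVec_smul r x }
  map_one' := LinearMap.ext fun x => one_mulVec x
  map_mul' A B := LinearMap.ext fun x => (mulVec_mulVec x A B).symm
  map_zero' := LinearMap.ext fun x => zero_mulVec x
  map_add' A B := LinearMap.ext fun x => add_mulVec A B x
  commutes' r := by
    refine LinearMap.ext fun x => ?_
    change (algebraMap ℝ (Matrix (Fin n) (Fin n) D) r) *ᵥ x = r • x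
    rw [Algebra.algebraMap_eq_smul_one, smul_mulVec, one_mulVec]

@[simp]
theorem realEnd_apply [Algebra ℝ D] (A : Matrix (Fin n) (Fin n) D) (x : Fin n → D) :
    realEnd A x = A *ᵥ x := rfl

@[simp]
theorem rightLin_apply (A : Matrix (Fin n) (Fin n) D) (x : Fin n → D) :
    rightLin A x = A *ᵥ x := rfl

theorem ext_of_mulVec {A B : Matrix (Fin n) (Fin n) D} (h : ∀ x, A *ᵥ x = B *ᵥ x) : A = B := by
  ext i j
  simpa using congrFun (h (Pi.single j 1)) i

theorem realEnd_injective [Algebra ℝ D] :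
    Function.Injective (realEnd : Matrix (Fin n) (Fin n) D →ₐ[ℝ] _) := fun _ _ h =>
  ext_of_mulVec fun x => LinearMap.congr_fun h x

theorem rightLin_pow (A : Matrix (Fin n) (Fin n) D) (m : ℕ) :
    rightLin (A ^ m) = rightLin A ^ m := by
  induction m with
  | zero => exact LinearMap.ext fun x => one_mulVec x
  | succ m ih =>
    refine LinearMap.ext fun x => ?_
    rw [pow_succ, pow_succ, ← ih, Module.End.mul_apply, rightLin_apply, rightLin_apply,
      rightLin_apply, mulVec_mulVec]

instance finite_mulOpposite_self : Module.Finite Dᵐᵒᵖ D :=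
  Module.Finite.equiv (MulOpposite.opLinearEquiv Dᵐᵒᵖ : D ≃ₗ[Dᵐᵒᵖ] Dᵐᵒᵖ).symm

theorem finrank_column : Module.finrank Dᵐᵒᵖ (Fin n → D) = n := by
  have : Module.finrank Dᵐᵒᵖ D = 1 := by
    rw [← Module.finrank_self Dᵐᵒᵖ]
    exact (MulOpposite.opLinearEquiv Dᵐᵒᵖ : D ≃ₗ[Dᵐᵒᵖ] Dᵐᵒᵖ).finrank_eq
  rw [Module.finrank_pi_fintype]
  simp [this]

theorem rightSpectrum_conj_subset (P : (Matrix (Fin n) (Fin n) D)ˣ)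
    (A : Matrix (Fin n) (Fin n) D) :
    (P⁻¹.val * A * P.val).rightSpectrum ⊆ A.rightSpectrum := by
  rintro c ⟨x, hx0, hx⟩
  refine ⟨P.val *ᵥ x, ?_, ?_⟩
  · intro h
    apply hx0
    have := congrArg (fun y => P⁻¹.val *ᵥ y) h
    simpa [mulVec_mulVec] using this
  · have := congrArg (fun y => P.val *ᵥ y) hx
    simp only [mulVec_mulVec, ← mul_assoc, Units.mul_inv, one_mul] at this
    rw [mulVec_mulVec, this]
    exact P.val.mulVec_smul (MulOpposite.op c) x

/-- The columns supported on the first `m` coordinates. -/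
def initialColumns [Algebra ℝ D] (n m : ℕ) : Submodule ℝ (Fin n → D) where
  carrier := {x | ∀ l : Fin n, m ≤ l.val → x l = 0}
  add_mem' hx hy l hl := by simp [hx l hl, hy l hl]
  zero_mem' l _ := rfl
  smul_mem' c x hx l hl := by simp [hx l hl]

variable [Algebra ℝ D]

/-- The map `x ↦ T x - x (T i i)` is in general only real-linear. Were it injective, it would be
bijective on the columns supported before `i`. It sends the `i`-th basis column among these, so that
column would equal its preimage there, which has `i`-th entry zero. -/
theorem diag_mem_rightSpectrum [FiniteDimensional ℝ D] {T : Matrix (Fin n) (Fin n) D}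
    (hT : ∀ i j : Fin n, j < i → T i j = 0) (i : Fin n) : T i i ∈ T.rightSpectrum := by
  by_contra hnot
  let f : (Fin n → D) →ₗ[ℝ] (Fin n → D) :=
    { toFun := fun x => fun l => (T *ᵥ x) l - x l * T i i
      map_add' := fun x y => by
        ext l; simp only [mulVec_add, Pi.add_apply, add_mul]; abel
      map_smul' := fun r x => by
        ext l; simp [mulVec_smul, smul_sub] }
  have hf : ∀ x, f x = 0 → x = 0 := by
    intro x hx
    by_contra hx0
    exact hnot ⟨x, hx0, funext fun l => sub_eq_zero.1 (congrFun hx l)⟩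
  have hmap : ∀ x ∈ initialColumns (D := D) n i, f x ∈ initialColumns (D := D) n i := by
    intro x hx l hl
    change (∑ j, T l j * x j) - x l * T i i = 0
    rw [hx l hl, zero_mul, sub_zero]
    refine Finset.sum_eq_zero fun j _ => ?_
    by_cases hj : j < l
    · rw [hT l j hj, zero_mul]
    · rw [hx j (hl.trans (not_lt.1 hj)), mul_zero]
  have hinj : Function.Injective (f.restrict hmap) := by
    rw [← LinearMap.ker_eq_bot, LinearMap.ker_eq_bot']
    intro x hx
    exact Subtype.ext (hf x (congrArg Subtype.val hx))
  have hsurj := LinearMap.injective_iff_surjective.1 hinj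
  have hei : f (Pi.single i 1) ∈ initialColumns (D := D) n i := by
    intro l hl
    change (T *ᵥ Pi.single i 1) l - (Pi.single i (1 : D) : Fin n → D) l * T i i = 0
    rw [mulVec_single_one]
    rcases eq_or_ne l i with rfl | hli
    · simp
    · have : i < l := lt_of_le_of_ne hl hli.symm
      simp [hT l i this, hli]
  obtain ⟨w, hw⟩ := hsurj ⟨_, hei⟩
  have hw' : f w.1 = f (Pi.single i 1) := congrArg Subtype.val hw
  have h0 := hf (w.1 - Pi.single i 1) (by rw [map_sub, hw', sub_self])
  have h1 := congrFun h0 i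
  rw [Pi.sub_apply, w.2 i le_rfl] at h1
  simp at h1

open Polynomial in
-- The factor for `d m` maps columns supported on the first `m + 1` coordinates to columns supported
-- on the first `m`.
theorem aeval_prod_eq_zero_of_upper {T : Matrix (Fin n) (Fin n) D}
    (hT : ∀ i j : Fin n, j < i → T i j = 0) (d : ℕ → ℝ)
    (hd : ∀ i : Fin n, T i i = algebraMap ℝ D (d i)) :
    aeval T (∏ i ∈ Finset.range n, (X - C (d i))) = 0 := by
  have key : ∀ m : ℕ, m ≤ n → ∀ x ∈ initialColumns (D := D) n m,
      aeval (realEnd T) (∏ i ∈ Finset.range m, (X - C (d i))) x = 0 := by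
    intro m
    induction m with
    | zero =>
      intro _ x hx
      have : x = 0 := funext fun l => hx l (Nat.zero_le _)
      rw [this, map_zero]
    | succ m ih =>
      intro hm x hx
      rw [Finset.prod_range_succ, map_mul, Module.End.mul_apply]
      refine ih (by omega) _ ?_
      intro l hl
      have h1 : (aeval (realEnd T) (X - C (d m)) x) l = (∑ j, T l j * x j) - d m • x l := by
        rw [map_sub, aeval_X, aeval_C]; rfl
      rw [h1]
      rcases eq_or_lt_of_le hl with hlm | hlm
      · rw [Finset.sum_eq_single l]
        · rw [hd l, ← hlm, Algebra.smul_def, sub_self]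
        · intro j _ hj
          rcases lt_or_gt_of_ne hj with h | h
          · rw [hT l j h, zero_mul]
          · rw [hx j (by have : l.val < j.val := h; omega), mul_zero]
        · simp
      · rw [hx l hlm, smul_zero, sub_zero]
        refine Finset.sum_eq_zero fun j _ => ?_
        by_cases hj : j < l
        · rw [hT l j hj, zero_mul]
        · rw [hx j (by have : l.val ≤ j.val := not_lt.1 hj; omega), mul_zero]
  apply realEnd_injective
  rw [map_zero, ← Polynomial.aeval_algHom_apply]
  exact LinearMap.ext fun x => key n le_rfl x fun l hl => absurd l.2 (by omega)

open Polynomial in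
/-- A triangularizable matrix with real spectrum is killed by a split real polynomial. -/
theorem exists_splits_aeval_eq_zero [FiniteDimensional ℝ D] {A : Matrix (Fin n) (Fin n) D} (hA : A.IsTriangularizable)
    (hs : A.rightSpectrum ⊆ Set.range (algebraMap ℝ D)) :
    ∃ p : ℝ[X], p.Splits ∧ p ≠ 0 ∧ aeval A p = 0 := by
  obtain ⟨P, hP⟩ := hA
  choose d hd using fun i => hs (rightSpectrum_conj_subset P A (diag_mem_rightSpectrum hP i))
  let d' : ℕ → ℝ := fun i => if h : i < n then d ⟨i, h⟩ else 0
  refine ⟨∏ i ∈ Finset.range n, (X - C (d' i)), Splits.prod fun i _ => Splits.X_sub_C _,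
    Finset.prod_ne_zero_iff.2 fun i _ => X_sub_C_ne_zero _, ?_⟩
  have h := aeval_prod_eq_zero_of_upper hP d' fun i => by simp [d', hd]
  have hconj : ∀ p : ℝ[X], aeval (P⁻¹.val * A * P.val) p = P⁻¹.val * aeval A p * P.val := by
    intro p
    have := Polynomial.aeval_algHom_apply
      (MulSemiringAction.toAlgEquiv ℝ (Matrix (Fin n) (Fin n) D) (ConjAct.toConjAct P⁻¹)) A p
    simpa [ConjAct.units_smul_def] using this
  rw [hconj] at h
  have h2 := congrArg (fun M => P.val * M * P⁻¹.val) h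
  simpa [mul_assoc] using h2

theorem realEnd_sub_pow_apply {A : Matrix (Fin n) (Fin n) D} (r : ℝ) (m : ℕ) (x : Fin n → D) :
    ((realEnd A - algebraMap ℝ _ r) ^ m) x = ((A - r • 1) ^ m) *ᵥ x := by
  rw [← realEnd_apply, map_pow, map_sub, map_smul, map_one, Algebra.algebraMap_eq_smul_one]

/-- The generalized eigenspace is a right `D`-subspace, and the exponent `n` exhausts it because `D
^ n` has dimension `n` over `D`, although its real dimension may be larger. -/
theorem finrank_maxGenEigenspace_realEnd [FiniteDimensional ℝ D] (A : Matrix (Fin n) (Fin n) D) (r : ℝ) :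
    Module.finrank ℝ ((realEnd A).maxGenEigenspace r) =
      Module.finrank ℝ D * A.realMultiplicity r := by
  set N := LinearMap.ker (rightLin ((A - r • (1 : Matrix _ _ D)) ^ n)) with hN
  have h1 : (realEnd A).maxGenEigenspace r = N.restrictScalars ℝ := by
    ext x
    rw [Module.End.mem_maxGenEigenspace, Submodule.restrictScalars_mem, hN, LinearMap.mem_ker,
      rightLin_apply]
    simp_rw [show (r • (1 : Module.End ℝ (Fin n → D))) = algebraMap ℝ _ r from
      (Algebra.algebraMap_eq_smul_one r).symm, realEnd_sub_pow_apply]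
    refine ⟨fun ⟨m, hm⟩ => ?_, fun h => ⟨n, h⟩⟩
    have h2 := Module.End.ker_pow_le_ker_pow_finrank (rightLin (A - r • 1)) m
    rw [finrank_column, ← rightLin_pow, ← rightLin_pow] at h2
    exact h2 hm
  rw [h1, realMultiplicity, ← hN]
  have h3 : Module.finrank ℝ Dᵐᵒᵖ = Module.finrank ℝ D :=
    (MulOpposite.opLinearEquiv ℝ).symm.finrank_eq
  rw [← h3, Module.finrank_mul_finrank ℝ Dᵐᵒᵖ N]
  rfl

theorem hasEigenvalue_realEnd_iff {A : Matrix (Fin n) (Fin n) D} {r : ℝ} :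
    (realEnd A).HasEigenvalue r ↔ algebraMap ℝ D r ∈ A.rightSpectrum := by
  have h : ∀ x : Fin n → D, r • x = fun i => x i * algebraMap ℝ D r := fun x => by
    ext i; rw [Pi.smul_apply, Algebra.smul_def, Algebra.commutes]
  constructor
  · intro h1
    obtain ⟨x, hx⟩ := h1.exists_hasEigenvector
    exact ⟨x, hx.2, by rw [← h, ← hx.apply_eq_smul, realEnd_apply]⟩
  · rintro ⟨x, hx0, hx⟩
    exact Module.End.hasEigenvalue_of_hasEigenvector
      (Module.End.hasEigenvector_iff.2 ⟨Module.End.mem_eigenspace_iff.2 (by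
        rw [realEnd_apply, hx, h]), hx0⟩)

theorem trace_realEnd_eq [FiniteDimensional ℝ D]
    {A : Matrix (Fin n) (Fin n) D} (hA : A.IsTriangularizable)
    (hs : A.rightSpectrum ⊆ Set.range (algebraMap ℝ D)) :
    LinearMap.trace ℝ _ (realEnd A) = Module.finrank ℝ D * A.eigenvalueSum := by
  classical
  obtain ⟨p, hp, hp0, hpA⟩ := exists_splits_aeval_eq_zero hA hs
  have hsp : (realEnd A).charpoly.Splits :=
    Module.End.splits_charpoly_of_aeval_eq_zero _ hp hp0 (by
      rw [Polynomial.aeval_algHom_apply, hpA, map_zero])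
  have hset : {r : ℝ | algebraMap ℝ D r ∈ A.rightSpectrum} =
      ((realEnd A).charpoly.roots.toFinset : Set ℝ) := by
    ext r
    rw [Set.mem_ofPred_eq, ← hasEigenvalue_realEnd_iff,
      Module.End.hasEigenvalue_iff_isRoot_charpoly, Finset.mem_coe, Multiset.mem_toFinset,
      Polynomial.mem_roots (LinearMap.charpoly_monic _).ne_zero]
  rw [Module.End.trace_eq_sum_roots_charpoly_of_splits hsp, eigenvalueSum, hset,
    finsum_mem_coe_finset, Finset.sum_multiset_count, Finset.mul_sum]
  refine Finset.sum_congr rfl fun r _ => ?_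
  rw [Polynomial.count_roots, ← LinearMap.finrank_maxGenEigenspace_eq,
    finrank_maxGenEigenspace_realEnd, nsmul_eq_mul, Nat.cast_mul, mul_assoc]

end Matrix

/-! ### The trace form on an irreducible semigroup, and finiteness -/

namespace Matrix

variable {D : Type*} [DivisionRing D] {n : ℕ} {S : Subsemigroup (Matrix (Fin n) (Fin n) D)}

theorem IsIrreducibleFamily.span_orbit
    (hirr : IsIrreducibleFamily (S : Set (Matrix (Fin n) (Fin n) D))) {x : Fin n → D}
    (hx : x ≠ 0) : Submodule.span Dᵐᵒᵖ {y | ∃ A ∈ S, y = A *ᵥ x} = ⊤ := by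
  have := hirr x hx
  rwa [Subsemigroup.closure_eq] at this

theorem IsIrreducibleFamily.eq_of_orbit
    (hirr : IsIrreducibleFamily (S : Set (Matrix (Fin n) (Fin n) D))) {x : Fin n → D}
    (hx : x ≠ 0) {M N : Matrix (Fin n) (Fin n) D}
    (h : ∀ A ∈ S, M *ᵥ (A *ᵥ x) = N *ᵥ (A *ᵥ x)) : M = N := by
  have h1 : rightLin M = rightLin N := by
    refine LinearMap.ext_on (hirr.span_orbit hx) ?_
    rintro _ ⟨A, hA, rfl⟩
    exact h A hA
  exact ext_of_mulVec fun y => LinearMap.congr_fun h1 y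

theorem IsIrreducibleFamily.exists_mulVec_ne_zero
    (hirr : IsIrreducibleFamily (S : Set (Matrix (Fin n) (Fin n) D))) {x : Fin n → D}
    (hx : x ≠ 0) {M : Matrix (Fin n) (Fin n) D} (hM : M ≠ 0) :
    ∃ A ∈ S, M *ᵥ (A *ᵥ x) ≠ 0 := by
  by_contra! h
  exact hM (hirr.eq_of_orbit hx fun A hA => by rw [h A hA, zero_mulVec])

variable [Algebra ℝ D]

theorem span_mul_mem {A B : Matrix (Fin n) (Fin n) D}
    (hA : A ∈ Submodule.span ℝ (S : Set (Matrix (Fin n) (Fin n) D)))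
    (hB : B ∈ Submodule.span ℝ (S : Set (Matrix (Fin n) (Fin n) D))) :
    A * B ∈ Submodule.span ℝ (S : Set (Matrix (Fin n) (Fin n) D)) := by
  have h := Submodule.mul_mem_mul hA hB
  rw [Submodule.span_mul_span] at h
  refine Submodule.span_mono ?_ h
  rintro _ ⟨a, ha, b, hb, rfl⟩
  exact S.mul_mem ha hb

/-- A nonzero real subspace of minimal dimension among those invariant under `S`. -/
theorem exists_minimal_invariant [FiniteDimensional ℝ D] (hn : 0 < n)
    (S : Subsemigroup (Matrix (Fin n) (Fin n) D)) :
    ∃ W : Submodule ℝ (Fin n → D), W ≠ ⊥ ∧ (∀ A ∈ S, ∀ w ∈ W, A *ᵥ w ∈ W) ∧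
      ∀ W' : Submodule ℝ (Fin n → D), W' ≠ ⊥ → (∀ A ∈ S, ∀ w ∈ W', A *ᵥ w ∈ W') →
        W' ≤ W → W' = W := by
  have hne : ({W | W ≠ ⊥ ∧ ∀ A ∈ S, ∀ w ∈ W, A *ᵥ w ∈ W} :
      Set (Submodule ℝ (Fin n → D))).Nonempty := by
    have : Nonempty (Fin n) := ⟨⟨0, hn⟩⟩
    exact ⟨⊤, top_ne_bot, fun _ _ _ _ => Submodule.mem_top⟩
  obtain ⟨W, hW, hmin⟩ := WellFounded.has_min
    (wellFounded_lt : WellFounded ((· < ·) : Submodule ℝ (Fin n → D) → _ → Prop)) _ hne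
  refine ⟨W, hW.1, hW.2, fun W' h0 hinv hle => ?_⟩
  by_contra hneq
  exact hmin W' ⟨h0, hinv⟩ (lt_of_le_of_ne hle hneq)

/-- The trace form is nondegenerate on the real span of an irreducible semigroup. -/
theorem eq_zero_of_trace_mul_eq_zero [FiniteDimensional ℝ D] (hn : 0 < n)
    (hirr : IsIrreducibleFamily (S : Set (Matrix (Fin n) (Fin n) D)))
    {X : Matrix (Fin n) (Fin n) D}
    (hX : X ∈ Submodule.span ℝ (S : Set (Matrix (Fin n) (Fin n) D)))
    (ht : ∀ C ∈ Submodule.span ℝ (S : Set (Matrix (Fin n) (Fin n) D)),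
      LinearMap.trace ℝ _ (realEnd (X * C)) = 0) : X = 0 := by
  obtain ⟨W, hW0, hWinv, hWmin⟩ := exists_minimal_invariant hn S
  have hspan : ∀ C ∈ Submodule.span ℝ (S : Set (Matrix (Fin n) (Fin n) D)),
      ∀ w ∈ W, C *ᵥ w ∈ W := by
    intro C hC w hw
    induction hC using Submodule.span_induction with
    | mem A hA => exact hWinv A hA w hw
    | zero => rw [zero_mulVec]; exact W.zero_mem
    | add A B _ _ hA hB => rw [add_mulVec]; exact W.add_mem hA hB
    | smul r A _ hA => rw [smul_mulVec]; exact W.smul_mem r hA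
  -- If `X w ≠ 0`, minimality of `W` gives `C` in the span with `C X w = w`. But all positive powers
  -- of `C X` have trace zero, so `C X` is nilpotent.
  have hkill : ∀ w ∈ W, X *ᵥ w = 0 := by
    intro w hw
    by_contra hy
    let ev : Matrix (Fin n) (Fin n) D →ₗ[ℝ] (Fin n → D) :=
      (LinearMap.applyₗ (X *ᵥ w)).comp (realEnd (D := D) (n := n)).toLinearMap
    have hev : ∀ C, ev C = C *ᵥ (X *ᵥ w) := fun C => rfl
    have hWW : (Submodule.span ℝ (S : Set (Matrix (Fin n) (Fin n) D))).map ev = W := by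
      apply hWmin
      · intro hbot
        obtain ⟨A, hA, hAy⟩ := hirr.exists_mulVec_ne_zero hy (M := 1) (by
          rintro h1
          apply hy
          rw [← one_mulVec (X *ᵥ w), h1, zero_mulVec])
        rw [one_mulVec] at hAy
        have : ev A ∈ (⊥ : Submodule ℝ (Fin n → D)) := by
          rw [← hbot]
          exact Submodule.mem_map_of_mem (Submodule.subset_span hA)
        exact hAy this
      · rintro A hA _ ⟨C, hC, rfl⟩
        refine ⟨A * C, span_mul_mem (Submodule.subset_span hA) hC, ?_⟩
        simp only [hev, mulVec_mulVec, mul_assoc]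
      · rintro _ ⟨C, hC, rfl⟩
        exact hspan C hC _ (hspan X hX w hw)
    obtain ⟨C, hC, hCw⟩ : w ∈ (Submodule.span ℝ (S : Set (Matrix (Fin n) (Fin n) D))).map ev := by
      rw [hWW]; exact hw
    rw [hev] at hCw
    have hpow : ∀ m : ℕ, (C * X) ^ m * C ∈
        Submodule.span ℝ (S : Set (Matrix (Fin n) (Fin n) D)) := by
      intro m
      induction m with
      | zero => simpa using hC
      | succ m ih =>
        rw [pow_succ', mul_assoc, mul_assoc]
        exact span_mul_mem hC (span_mul_mem hX ih)
    have hnil : IsNilpotent (realEnd (C * X)) := by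
      apply LinearMap.isNilpotent_of_forall_trace_pow_eq_zero
      intro m
      rw [← map_pow, pow_succ, ← mul_assoc, map_mul, LinearMap.trace_mul_comm, ← map_mul]
      exact ht _ (hpow m)
    obtain ⟨N, hN⟩ := hnil
    have hfix : ∀ m : ℕ, (realEnd (C * X) ^ m) w = w := by
      intro m
      induction m with
      | zero => rfl
      | succ m ih =>
        rw [pow_succ, Module.End.mul_apply, realEnd_apply, ← mulVec_mulVec, hCw, ih]
    have := hfix N
    rw [hN, LinearMap.zero_apply] at this
    apply hy
    rw [← this, mulVec_zero]
  -- `W` is only a real subspace, but it contains the orbit of `w`, which spans over `D`.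
  obtain ⟨w, hw, hw0⟩ := W.ne_bot_iff.1 hW0
  exact hirr.eq_of_orbit hw0 fun A hA => by rw [hkill _ (hWinv A hA w hw), zero_mulVec]

/-- With a spanning family `f i` of the real span chosen inside `S`, the traces of `A * f i`
determine `A` and all lie in the given finite set. -/
theorem finite_of_finite_trace [FiniteDimensional ℝ D] (hn : 0 < n)
    (hirr : IsIrreducibleFamily (S : Set (Matrix (Fin n) (Fin n) D)))
    (ht : ((fun A => LinearMap.trace ℝ _ (realEnd A)) ''
      (S : Set (Matrix (Fin n) (Fin n) D))).Finite) :
    (S : Set (Matrix (Fin n) (Fin n) D)).Finite := by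
  obtain ⟨f, hf, hfspan, -⟩ := Submodule.exists_fun_fin_finrank_span_eq ℝ
    (S : Set (Matrix (Fin n) (Fin n) D))
  let Φ : Matrix (Fin n) (Fin n) D → _ → ℝ :=
    fun A i => LinearMap.trace ℝ _ (realEnd (A * f i))
  refine Set.Finite.of_finite_image (f := Φ) ?_ ?_
  · refine (Set.Finite.pi' fun _ => ht).subset ?_
    rintro _ ⟨A, hA, rfl⟩ i
    exact ⟨A * f i, S.mul_mem hA (hf i), rfl⟩
  · intro A hA B hB hAB
    rw [← sub_eq_zero]
    refine eq_zero_of_trace_mul_eq_zero hn hirr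
      (Submodule.sub_mem _ (Submodule.subset_span hA) (Submodule.subset_span hB)) ?_
    intro C hC
    rw [← hfspan] at hC
    induction hC using Submodule.span_induction with
    | mem C hC =>
      obtain ⟨i, rfl⟩ := hC
      rw [sub_mul, map_sub, map_sub, sub_eq_zero]
      exact congrFun hAB i
    | zero => rw [mul_zero, map_zero, map_zero]
    | add C C' _ _ h h' => rw [mul_add, map_add, map_add, h, h', add_zero]
    | smul r C _ h => rw [mul_smul_comm, map_smul, map_smul, h, smul_zero]

end Matrix

/-! ### A rank-one member of a finite irreducible semigroup -/

open Polynomial in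
/-- An element of finite order which is killed by a split real polynomial has eigenvalues among
`0, 1, -1`. -/
theorem pow_three_eq_self_of_splits {R : Type*} [Ring R] [Algebra ℝ R] {g : R} {p : ℝ[X]}
    (hp : p.Splits) (hp0 : p ≠ 0) (hg : aeval g p = 0) {m : ℕ} (hm : m ≠ 0)
    (hgm : g ^ (m + 1) = g) : g ^ 3 = g := by
  have hint : IsIntegral ℝ g := isAlgebraic_iff_isIntegral.1 ⟨p, hp0, hg⟩
  have hq0 : minpoly ℝ g ≠ 0 := minpoly.ne_zero hint
  have hqs : (minpoly ℝ g).Splits := hp.of_dvd hp0 (minpoly.dvd ℝ g hg)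
  have hqd : minpoly ℝ g ∣ X * (X ^ m - 1) :=
    minpoly.dvd ℝ g (by
      rw [map_mul, map_sub, map_pow, aeval_X, map_one, mul_sub, ← pow_succ', hgm, mul_one,
        sub_self])
  -- Separability makes the roots of the minimal polynomial simple, so it suffices that each is a
  -- root of `X ^ 3 - X`.
  have hsep : (X * (X ^ m - 1) : ℝ[X]).Separable := by
    refine separable_X.mul (X_pow_sub_one_separable_iff.2 (by exact_mod_cast hm)) ?_
    refine (Polynomial.prime_X.coprime_iff_not_dvd).2 ?_
    rw [X_dvd_iff]
    simp [coeff_X_pow, hm.symm]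
  have hnodup := nodup_roots (hsep.of_dvd hqd)
  have hc0 : (X ^ 3 - X : ℝ[X]) ≠ 0 := fun h => by
    have := congrArg (eval 2) h
    norm_num at this
  have hdvd : minpoly ℝ g ∣ X ^ 3 - X := by
    rw [Splits.dvd_iff_roots_le_roots hqs hq0 hc0, Multiset.le_iff_subset hnodup]
    intro c hc
    have h1 : eval c (X * (X ^ m - 1) : ℝ[X]) = 0 :=
      eval_eq_zero_of_dvd_of_eval_eq_zero hqd (isRoot_of_mem_roots hc)
    rw [mem_roots hc0]
    simp only [eval_mul, eval_X, eval_sub, eval_pow, eval_one, mul_eq_zero] at h1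
    simp only [IsRoot, eval_sub, eval_pow, eval_X]
    rcases h1 with rfl | h1
    · norm_num
    · rcases (pow_eq_one_iff_cases).1 (sub_eq_zero.1 h1) with h | rfl | ⟨rfl, -⟩
      · exact absurd h hm
      · norm_num
      · norm_num
  have := (minpoly.dvd_iff).1 hdvd
  rwa [map_sub, map_pow, aeval_X, sub_eq_zero] at this

namespace Matrix

variable {D : Type*} [DivisionRing D] {n : ℕ} {S : Subsemigroup (Matrix (Fin n) (Fin n) D)}

theorem pow_succ_mem {A : Matrix (Fin n) (Fin n) D} (hA : A ∈ S) (m : ℕ) : A ^ (m + 1) ∈ S := by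
  induction m with
  | zero => simpa using hA
  | succ m ih => rw [pow_succ]; exact S.mul_mem ih hA

/-- Two powers of `C` coincide by finiteness, and injectivity on `U` allows the smaller one to be
cancelled. -/
theorem exists_pow_fixes_of_injOn (hfin : (S : Set (Matrix (Fin n) (Fin n) D)).Finite)
    {C : Matrix (Fin n) (Fin n) D} (hC : C ∈ S) {U : Submodule Dᵐᵒᵖ (Fin n → D)}
    (hrange : ∀ x, C *ᵥ x ∈ U) (hinj : ∀ y ∈ U, C *ᵥ y = 0 → y = 0) :
    ∃ m : ℕ, ∀ y ∈ U, C ^ (m + 1) *ᵥ y = y := by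
  have hpow : ∀ m : ℕ, ∀ y ∈ U, C ^ m *ᵥ y ∈ U ∧ (C ^ m *ᵥ y = 0 → y = 0) := by
    intro m
    induction m with
    | zero => intro y hy; simp [hy]
    | succ m ih =>
      intro y hy
      rw [pow_succ, ← mulVec_mulVec]
      obtain ⟨h1, h2⟩ := ih _ (hrange y)
      exact ⟨h1, fun h => hinj y hy (h2 h)⟩
  obtain ⟨i, j, hij, heq⟩ := hfin.exists_lt_map_eq_of_forall_mem
    (f := fun i : ℕ => C ^ (i + 1)) fun i => pow_succ_mem hC i
  refine ⟨j - i - 1, fun y hy => ?_⟩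
  rw [← sub_eq_zero]
  refine (hpow (i + 1) _ (U.sub_mem (hpow _ y hy).1 hy)).2 ?_
  rw [mulVec_sub, mulVec_mulVec, ← pow_add, show i + 1 + (j - i - 1 + 1) = j + 1 by omega,
    sub_eq_zero]
  exact congrArg (· *ᵥ y) heq.symm

theorem exists_minimal_range (hn : 0 < n)
    (hirr : IsIrreducibleFamily (S : Set (Matrix (Fin n) (Fin n) D))) :
    ∃ A ∈ S, A ≠ 0 ∧ ∀ B ∈ S, B ≠ 0 → (∀ x, B *ᵥ x ∈ LinearMap.range (rightLin A)) →
      LinearMap.range (rightLin B) = LinearMap.range (rightLin A) := by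
  have : Nonempty (Fin n) := ⟨⟨0, hn⟩⟩
  obtain ⟨x, hx⟩ := exists_ne (0 : Fin n → D)
  obtain ⟨A₀, hA₀, h0⟩ := hirr.exists_mulVec_ne_zero hx (M := 1) one_ne_zero
  have hne : ({A | A ∈ S ∧ A ≠ 0} : Set (Matrix (Fin n) (Fin n) D)).Nonempty := by
    refine ⟨A₀, hA₀, ?_⟩
    rintro rfl
    simp at h0
  obtain ⟨A, hA, hmin⟩ := WellFounded.has_min
    (measure fun A : Matrix (Fin n) (Fin n) D =>
      Module.finrank Dᵐᵒᵖ (LinearMap.range (rightLin A))).wf _ hne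
  refine ⟨A, hA.1, hA.2, fun B hB hB0 hle => ?_⟩
  refine Submodule.eq_of_le_of_finrank_le ?_ (not_lt.1 (hmin B ⟨hB, hB0⟩))
  rintro _ ⟨x, rfl⟩
  exact hle x

/-- If `A` is nonzero of minimal range in `S`, an element of `S` with range inside that of `A`
which does not vanish there acts injectively on it. -/
theorem injOn_range_of_minimal {A : Matrix (Fin n) (Fin n) D} (hA : A ∈ S)
    (hmin : ∀ B ∈ S, B ≠ 0 → (∀ x, B *ᵥ x ∈ LinearMap.range (rightLin A)) →
      LinearMap.range (rightLin B) = LinearMap.range (rightLin A))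
    {G : Matrix (Fin n) (Fin n) D} (hG : G ∈ S)
    (hrange : ∀ x, G *ᵥ x ∈ LinearMap.range (rightLin A))
    {z : Fin n → D} (hz : z ∈ LinearMap.range (rightLin A)) (hGz : G *ᵥ z ≠ 0) :
    ∀ y ∈ LinearMap.range (rightLin A), G *ᵥ y = 0 → y = 0 := by
  -- By minimality `G` maps the range of `A` onto itself, hence injectively by finite dimension.
  have hGA : LinearMap.range (rightLin (G * A)) = LinearMap.range (rightLin A) := by
    refine hmin _ (S.mul_mem hG hA) ?_ fun x => by rw [← mulVec_mulVec]; exact hrange _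
    intro h
    obtain ⟨x, rfl⟩ := hz
    rw [rightLin_apply, mulVec_mulVec, h, zero_mulVec] at hGz
    exact hGz rfl
  let f := (rightLin G).restrict (p := LinearMap.range (rightLin A))
    (q := LinearMap.range (rightLin A)) fun x _ => hrange x
  have hsurj : Function.Surjective f := by
    rintro ⟨y, hy⟩
    rw [← hGA] at hy
    obtain ⟨x, hx⟩ := hy
    refine ⟨⟨A *ᵥ x, x, rfl⟩, Subtype.ext ?_⟩
    exact (mulVec_mulVec x G A).trans hx
  have hinj := LinearMap.injective_iff_surjective.2 hsurj
  intro y hy hGy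
  have : f ⟨y, hy⟩ = f 0 := by
    rw [map_zero]; exact Subtype.ext hGy
  exact congrArg Subtype.val (hinj this)

/-- For `A` of minimal range, choose `B` so that `A * B` is nonzero on that range. It is then
injective there, and a power of it is a projection onto the range. -/
theorem exists_minimal_idempotent (hn : 0 < n)
    (hirr : IsIrreducibleFamily (S : Set (Matrix (Fin n) (Fin n) D)))
    (hfin : (S : Set (Matrix (Fin n) (Fin n) D)).Finite) :
    ∃ E ∈ S, E ≠ 0 ∧ E * E = E ∧ ∀ G ∈ S, E * G = G → ∀ z, E *ᵥ z = z → G *ᵥ z ≠ 0 →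
      ∀ y, E *ᵥ y = y → G *ᵥ y = 0 → y = 0 := by
  obtain ⟨A, hA, hA0, hmin⟩ := exists_minimal_range hn hirr
  obtain ⟨x, hx⟩ : ∃ x, A *ᵥ x ≠ 0 := by
    by_contra! h
    exact hA0 (ext_of_mulVec fun x => by rw [h, zero_mulVec])
  obtain ⟨B, hB, hABx⟩ := hirr.exists_mulVec_ne_zero hx hA0
  have hAB := S.mul_mem hA hB
  have hrange : ∀ y, (A * B) *ᵥ y ∈ LinearMap.range (rightLin A) := fun y =>
    ⟨B *ᵥ y, mulVec_mulVec y A B⟩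
  have hinj := injOn_range_of_minimal hA hmin hAB hrange ⟨x, rfl⟩
    (by rwa [rightLin_apply, ← mulVec_mulVec])
  obtain ⟨m, hm⟩ := exists_pow_fixes_of_injOn hfin hAB hrange hinj
  have hEr : ∀ y, (A * B) ^ (m + 1) *ᵥ y ∈ LinearMap.range (rightLin A) := fun y => by
    rw [pow_succ', ← mulVec_mulVec]; exact hrange _
  have hE : ∀ y, y ∈ LinearMap.range (rightLin A) ↔ (A * B) ^ (m + 1) *ᵥ y = y :=
    fun y => ⟨hm y, fun h => h ▸ hEr y⟩
  refine ⟨(A * B) ^ (m + 1), pow_succ_mem hAB m, ?_, ?_, ?_⟩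
  · intro h
    have := hm (A *ᵥ x) ⟨x, rfl⟩
    rw [h, zero_mulVec] at this
    exact hx this.symm
  · exact ext_of_mulVec fun y => by rw [← mulVec_mulVec, hm _ (hEr y)]
  · intro G hG hEG z hz hGz y hy hGy
    refine injOn_range_of_minimal hA hmin hG (fun x => ?_) ((hE z).2 hz) hGz y ((hE y).2 hy) hGy
    rw [← hEG, ← mulVec_mulVec]
    exact hEr _

variable [Algebra ℝ D]

open Polynomial in
/-- The nonzero elements of the corner `E S E` are involutions. -/
theorem corner_sq_eq (hfin : (S : Set (Matrix (Fin n) (Fin n) D)).Finite)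
    (hsplit : ∀ A ∈ S, ∃ p : ℝ[X], p.Splits ∧ p ≠ 0 ∧ aeval A p = 0)
    {E G : Matrix (Fin n) (Fin n) D} (hEE : E * E = E) (hG : G ∈ S) (hEG : E * G = G)
    (hGE : G * E = G) (hinj : ∀ y, E *ᵥ y = y → G *ᵥ y = 0 → y = 0) : G * G = E := by
  have hrange : ∀ x, G *ᵥ x ∈ LinearMap.range (rightLin E) := fun x =>
    ⟨G *ᵥ x, by rw [rightLin_apply, mulVec_mulVec, hEG]⟩
  have hU : ∀ y ∈ LinearMap.range (rightLin E), E *ᵥ y = y := by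
    rintro _ ⟨x, rfl⟩
    rw [rightLin_apply, mulVec_mulVec, hEE]
  obtain ⟨m, hm⟩ := exists_pow_fixes_of_injOn hfin hG hrange fun y hy => hinj y (hU y hy)
  have hpow : G ^ (m + 1 + 1) = G := ext_of_mulVec fun x => by
    rw [pow_succ, ← mulVec_mulVec, hm _ (hrange x)]
  obtain ⟨p, hp, hp0, hpG⟩ := hsplit G hG
  have h3 := pow_three_eq_self_of_splits hp hp0 hpG (Nat.succ_ne_zero m) hpow
  refine ext_of_mulVec fun x => ?_
  rw [← sub_eq_zero]
  apply hinj
  · rw [mulVec_sub, mulVec_mulVec, mulVec_mulVec, ← mul_assoc, hEG, hEE]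
  · rw [mulVec_sub, mulVec_mulVec, mulVec_mulVec, hGE,
      show G * (G * G) = G by simpa [pow_succ, mul_assoc] using h3, sub_self]

open Polynomial in
/-- A finite irreducible semigroup whose members are killed by split real polynomials contains a
matrix of rank one. -/
theorem exists_vecMulVec_mem (hn : 0 < n)
    (hirr : IsIrreducibleFamily (S : Set (Matrix (Fin n) (Fin n) D)))
    (hfin : (S : Set (Matrix (Fin n) (Fin n) D)).Finite)
    (hsplit : ∀ A ∈ S, ∃ p : ℝ[X], p.Splits ∧ p ≠ 0 ∧ aeval A p = 0) :
    ∃ u c : Fin n → D, u ≠ 0 ∧ c ≠ 0 ∧ vecMulVec u c ∈ S := by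
  obtain ⟨E, hES, hE0, hEE, hmin⟩ := exists_minimal_idempotent hn hirr hfin
  have hcorner : ∀ G ∈ S, E * G = G → G * E = G → G = 0 ∨
      (G * G = E ∧ ∀ y, E *ᵥ y = y → G *ᵥ y = 0 → y = 0) := by
    intro G hG hEG hGE
    by_cases h0 : G = 0
    · exact Or.inl h0
    · obtain ⟨x, hx⟩ : ∃ x, G *ᵥ x ≠ 0 := by
        by_contra! h
        exact h0 (ext_of_mulVec fun x => by rw [h, zero_mulVec])
      have hinj := hmin G hG hEG (E *ᵥ x) (by rw [mulVec_mulVec, hEE])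
        (by rwa [mulVec_mulVec, hGE])
      exact Or.inr ⟨corner_sq_eq hfin hsplit hEE hG hEG hGE hinj, hinj⟩
  -- As in a group of exponent two: `G`, `H` and `G * H` all square to `E`.
  have hcomm : ∀ G ∈ S, E * G = G → G * E = G → ∀ H ∈ S, E * H = H → H * E = H →
      G ≠ 0 → H ≠ 0 → H * G = G * H := by
    intro G hG hEG hGE H hH hEH hHE hG0 hH0
    obtain ⟨hGG, hGi⟩ := (hcorner G hG hEG hGE).resolve_left hG0
    obtain ⟨hHH, hHi⟩ := (hcorner H hH hEH hHE).resolve_left hH0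
    have hGH0 : G * H ≠ 0 := by
      intro h
      apply hE0
      rw [← hHH, ← hEH, ← hGG, mul_assoc G G H, h, mul_zero, zero_mul]
    obtain ⟨hsq, -⟩ := (hcorner (G * H) (S.mul_mem hG hH) (by rw [← mul_assoc, hEG])
      (by rw [mul_assoc, hHE])).resolve_left hGH0
    calc H * G = (G * G) * (H * G) * (H * H) := by
          rw [hGG, hHH, ← mul_assoc E, hEH, mul_assoc, hGE]
      _ = G * ((G * H) * (G * H)) * H := by simp only [mul_assoc]
      _ = G * H := by rw [hsq, hGE]
  obtain ⟨u, hu, hEu⟩ : ∃ u : Fin n → D, u ≠ 0 ∧ E *ᵥ u = u := by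
    obtain ⟨x, hx⟩ : ∃ x, E *ᵥ x ≠ 0 := by
      by_contra! h
      exact hE0 (ext_of_mulVec fun x => by rw [h, zero_mulVec])
    exact ⟨E *ᵥ x, hx, by rw [mulVec_mulVec, hEE]⟩
  have hmemc : ∀ B ∈ S, E * B * E ∈ S ∧ E * (E * B * E) = E * B * E ∧
      (E * B * E) * E = E * B * E := fun B hB =>
    ⟨S.mul_mem (S.mul_mem hES hB) hES, by rw [← mul_assoc, ← mul_assoc, hEE],
      by rw [mul_assoc, hEE]⟩
  -- If `G` fixes a nonzero `x` in the range of `E`, commutation makes it fix every `E B x`, and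
  -- these span that range, so `G = E`. Otherwise `u + G u`, which `G` fixes, must vanish.
  have hscalar : ∀ G ∈ S, E * G = G → G * E = G → G *ᵥ u = 0 ∨ G *ᵥ u = u ∨ G *ᵥ u = -u := by
    intro G hG hEG hGE
    rcases eq_or_ne G 0 with h0 | h0
    · exact Or.inl (by rw [h0, zero_mulVec])
    right
    obtain ⟨hGG, -⟩ := (hcorner G hG hEG hGE).resolve_left h0
    by_cases hx : ∃ x, x ≠ 0 ∧ E *ᵥ x = x ∧ G *ᵥ x = x
    · left
      obtain ⟨x, hx0, hEx, hGx⟩ := hx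
      have : G = E := by
        refine hirr.eq_of_orbit hx0 fun B hB => ?_
        obtain ⟨h1, h2, h3⟩ := hmemc B hB
        have h4 : E *ᵥ (B *ᵥ x) = (E * B * E) *ᵥ x := by
          rw [← mulVec_mulVec, hEx, mulVec_mulVec]
        rw [← hGE, ← mulVec_mulVec, h4, mulVec_mulVec]
        rcases eq_or_ne (E * B * E) 0 with h5 | h5
        · rw [h5, mul_zero]
        · rw [← hcomm G hG hEG hGE _ h1 h2 h3 h0 h5, ← mulVec_mulVec, hGx]
      rw [this, hEu]
    · right
      push Not at hx
      have h1 : u + G *ᵥ u = 0 := by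
        by_contra hne
        refine hx _ hne ?_ ?_
        · rw [mulVec_add, hEu, mulVec_mulVec, hEG]
        · rw [mulVec_add, mulVec_mulVec, hGG, hEu, add_comm]
      exact (neg_eq_of_add_eq_zero_right h1).symm
  -- `E` sends each `B u` to `0`, `u` or `-u`, and the orbit of `u` spans.
  have hline : ∀ v, E *ᵥ v ∈ Submodule.span Dᵐᵒᵖ {u} := by
    have hle : Submodule.span Dᵐᵒᵖ {y | ∃ A ∈ S, y = A *ᵥ u} ≤
        (Submodule.span Dᵐᵒᵖ {u}).comap (rightLin E) := by
      refine Submodule.span_le.2 ?_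
      rintro _ ⟨B, hB, rfl⟩
      change E *ᵥ (B *ᵥ u) ∈ Submodule.span Dᵐᵒᵖ {u}
      obtain ⟨h1, h2, h3⟩ := hmemc B hB
      have h4 : E *ᵥ (B *ᵥ u) = (E * B * E) *ᵥ u := by
        rw [← mulVec_mulVec, hEu, mulVec_mulVec]
      rw [h4]
      have hmu := Submodule.mem_span_singleton_self (R := Dᵐᵒᵖ) u
      rcases hscalar _ h1 h2 h3 with h | h | h <;> rw [h]
      · exact Submodule.zero_mem _
      · exact hmu
      · exact Submodule.neg_mem _ hmu
    rw [hirr.span_orbit hu] at hle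
    exact fun v => hle (Submodule.mem_top (x := v))
  choose c hc using fun j => Submodule.mem_span_singleton.1 (hline (Pi.single j 1))
  have hEuc : E = vecMulVec u fun j => (c j).unop := by
    ext i j
    have := congrFun (hc j) i
    rw [mulVec_single_one] at this
    exact this.symm
  refine ⟨u, fun j => (c j).unop, hu, ?_, hEuc ▸ hES⟩
  intro h
  apply hE0
  rw [hEuc, h, vecMulVec_zero]

end Matrix

/-! ### Counting members by `n ^ 2` eigenvalue sums -/

namespace Matrix

variable {D : Type*} [DivisionRing D] {n : ℕ} {S : Subsemigroup (Matrix (Fin n) (Fin n) D)}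

theorem exists_separating_orbit
    (hirr : IsIrreducibleFamily (S : Set (Matrix (Fin n) (Fin n) D))) {u : Fin n → D}
    (hu : u ≠ 0) : ∃ f : Fin n → Matrix (Fin n) (Fin n) D, (∀ i, f i ∈ S) ∧
      ∀ M N : Matrix (Fin n) (Fin n) D, (∀ i, M *ᵥ (f i *ᵥ u) = N *ᵥ (f i *ᵥ u)) → M = N := by
  obtain ⟨b, hb, hbspan, -⟩ := Submodule.exists_fun_fin_finrank_span_eq Dᵐᵒᵖ
    {y | ∃ A ∈ S, y = A *ᵥ u}
  have hcard : Module.finrank Dᵐᵒᵖ (Submodule.span Dᵐᵒᵖ {y | ∃ A ∈ S, y = A *ᵥ u}) = n := by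
    rw [hirr.span_orbit hu, finrank_top, finrank_column]
  replace hbspan := hbspan.trans (hirr.span_orbit hu)
  choose f hf hbf using hb
  refine ⟨fun i => f (Fin.cast hcard.symm i), fun i => hf _, fun M N h => ?_⟩
  have h1 : rightLin M = rightLin N := by
    refine LinearMap.ext_on hbspan ?_
    rintro _ ⟨i, rfl⟩
    rw [hbf]
    exact h (Fin.cast hcard i)
  exact ext_of_mulVec fun y => LinearMap.congr_fun h1 y

/-- As long as the common kernel of the `E * B j` is nonzero, irreducibility gives a further member
of `S` that shrinks it, so `n` members suffice. -/
theorem exists_separating_rows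
    (hirr : IsIrreducibleFamily (S : Set (Matrix (Fin n) (Fin n) D)))
    {E : Matrix (Fin n) (Fin n) D} (hE : E ≠ 0) :
    ∃ B : Fin n → Matrix (Fin n) (Fin n) D, (∀ j, B j ∈ S) ∧
      ∀ x : Fin n → D, (∀ j, E *ᵥ (B j *ᵥ x) = 0) → x = 0 := by
  have key : ∀ m : ℕ, ∃ B : Fin m → Matrix (Fin n) (Fin n) D, (∀ j, B j ∈ S) ∧
      Module.finrank Dᵐᵒᵖ (⨅ j, LinearMap.ker (rightLin (E * B j)) :
        Submodule Dᵐᵒᵖ (Fin n → D)) ≤ n - m := by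
    intro m
    induction m with
    | zero =>
      refine ⟨Fin.elim0, fun j => j.elim0, ?_⟩
      exact (Submodule.finrank_le _).trans finrank_column.le
    | succ m ih =>
      obtain ⟨B, hB, hrank⟩ := ih
      set K : Submodule Dᵐᵒᵖ (Fin n → D) := ⨅ j, LinearMap.ker (rightLin (E * B j)) with hK
      have hle : ∀ A, (⨅ j, LinearMap.ker (rightLin (E * (Fin.cons A B : Fin (m + 1) → _) j)) :
          Submodule Dᵐᵒᵖ (Fin n → D)) ≤ LinearMap.ker (rightLin (E * A)) ⊓ K := fun A =>
        le_inf (iInf_le_of_le 0 (by rw [Fin.cons_zero]))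
          (le_iInf fun j => iInf_le_of_le j.succ (by rw [Fin.cons_succ]))
      have hmem : ∀ A ∈ S, ∀ j, (Fin.cons A B : Fin (m + 1) → _) j ∈ S := fun A hA j => by
        refine Fin.cases ?_ (fun j => ?_) j
        · rwa [Fin.cons_zero]
        · rw [Fin.cons_succ]; exact hB j
      -- If the kernel is already zero, any member of `S` serves as padding.
      by_cases hbot : K = ⊥
      · obtain ⟨x, hx⟩ : ∃ x, E *ᵥ x ≠ 0 := by
          by_contra! h
          exact hE (ext_of_mulVec fun x => by rw [h, zero_mulVec])
        have hx0 : x ≠ 0 := by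
          rintro rfl
          exact hx (mulVec_zero E)
        obtain ⟨A, hA, -⟩ := hirr.exists_mulVec_ne_zero hx0 hE
        refine ⟨Fin.cons A B, hmem A hA, ?_⟩
        have := Submodule.finrank_mono ((hle A).trans inf_le_right)
        rw [hbot, finrank_bot] at this
        omega
      · obtain ⟨x, hxK, hx0⟩ := K.ne_bot_iff.1 hbot
        obtain ⟨A, hA, hAx⟩ := hirr.exists_mulVec_ne_zero hx0 hE
        refine ⟨Fin.cons A B, hmem A hA, ?_⟩
        have hlt : (⨅ j, LinearMap.ker (rightLin (E * (Fin.cons A B : Fin (m + 1) → _) j)) :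
            Submodule Dᵐᵒᵖ (Fin n → D)) < K := by
          refine lt_of_le_of_ne ((hle A).trans inf_le_right) fun heq => hAx ?_
          rw [← heq] at hxK
          have := (hle A hxK).1
          exact (mulVec_mulVec x E A).trans this
        have := Submodule.finrank_lt_finrank_of_lt hlt
        omega
  obtain ⟨B, hB, hrank⟩ := key n
  refine ⟨B, hB, fun x hx => ?_⟩
  rw [Nat.sub_self, Nat.le_zero, Submodule.finrank_eq_zero] at hrank
  rw [← Submodule.mem_bot Dᵐᵒᵖ, ← hrank, Submodule.mem_iInf]
  intro j
  rw [LinearMap.mem_ker, rightLin_apply, ← mulVec_mulVec, hx j]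

/-- With at most one member, an orbit would span dimension at most one. -/
theorem one_lt_encard (hn : 1 < n)
    (hirr : IsIrreducibleFamily (S : Set (Matrix (Fin n) (Fin n) D))) :
    1 < (S : Set (Matrix (Fin n) (Fin n) D)).encard := by
  by_contra! hle
  rw [Set.encard_le_one_iff] at hle
  have : Nonempty (Fin n) := ⟨⟨0, by omega⟩⟩
  obtain ⟨x, hx⟩ := exists_ne (0 : Fin n → D)
  obtain ⟨A, hA, -⟩ := hirr.exists_mulVec_ne_zero hx (M := 1) one_ne_zero
  have hsub : {y | ∃ B ∈ S, y = B *ᵥ x} ⊆ {A *ᵥ x} := by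
    rintro _ ⟨B, hB, rfl⟩
    rw [hle B A hB hA]
    rfl
  have h1 := Submodule.finrank_mono (Submodule.span_mono (R := Dᵐᵒᵖ) hsub)
  rw [hirr.span_orbit hx, finrank_top, finrank_column] at h1
  have h2 := finrank_span_le_card (R := Dᵐᵒᵖ) ({A *ᵥ x} : Set (Fin n → D))
  rw [Set.toFinset_singleton, Finset.card_singleton] at h2
  omega

variable [Algebra ℝ D] [FiniteDimensional ℝ D]

/-- The map factors through `D`. Composing the factors in the other order gives multiplication by
`r` on `D`, with the same trace. -/
theorem trace_realEnd_vecMulVec {v c : Fin n → D} {r : ℝ}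
    (h : c ⬝ᵥ v = algebraMap ℝ D r) :
    LinearMap.trace ℝ _ (realEnd (vecMulVec v c)) = Module.finrank ℝ D * r := by
  let f : (Fin n → D) →ₗ[ℝ] D :=
    { toFun := fun x => c ⬝ᵥ x
      map_add' := dotProduct_add c
      map_smul' := fun r x => dotProduct_smul r c x }
  let g : D →ₗ[ℝ] (Fin n → D) :=
    { toFun := fun q i => v i * q
      map_add' := fun q q' => funext fun i => mul_add _ _ _
      map_smul' := fun r q => funext fun i => mul_smul_comm r (v i) q }
  have hgf : realEnd (vecMulVec v c) = g ∘ₗ f := LinearMap.ext fun x => by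
    rw [realEnd_apply, vecMulVec_mulVec]
    rfl
  have hfg : f ∘ₗ g = r • LinearMap.id := LinearMap.ext fun q => by
    change ∑ i, c i * (v i * q) = r • q
    simp_rw [← mul_assoc]
    rw [← Finset.sum_mul, Algebra.smul_def, ← h]
    rfl
  rw [hgf, LinearMap.trace_comp_comm', hfg, map_smul, LinearMap.trace_id, smul_eq_mul, mul_comm]

/-- A nonzero `v` is a right eigenvector with eigenvalue `c ⬝ᵥ v`, which is therefore real.
Comparing the two trace formulas identifies it. -/
theorem dotProduct_eq_eigenvalueSum {v c : Fin n → D}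
    (htri : (vecMulVec v c).IsTriangularizable)
    (hs : (vecMulVec v c).rightSpectrum ⊆ Set.range (algebraMap ℝ D)) :
    c ⬝ᵥ v = algebraMap ℝ D (vecMulVec v c).eigenvalueSum := by
  obtain ⟨r, hr⟩ : ∃ r : ℝ, algebraMap ℝ D r = c ⬝ᵥ v := by
    rcases eq_or_ne v 0 with rfl | hv
    · exact ⟨0, by rw [map_zero, dotProduct_zero]⟩
    · exact hs ⟨v, hv, by rw [vecMulVec_mulVec]; rfl⟩
  have h1 := trace_realEnd_eq htri hs
  rw [trace_realEnd_vecMulVec hr.symm] at h1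
  have h2 : (Module.finrank ℝ D : ℝ) ≠ 0 := by exact_mod_cast Module.finrank_pos.ne'
  rw [← hr, mul_left_cancel₀ h2 h1]

/-- An irreducible semigroup of triangularizable matrices with real spectra has at most `k ^ n ^ 2`
elements if it has at most `k` eigenvalue sums. -/
theorem encard_le_of_eigenvalueSum (hn : 0 < n)
    (hirr : IsIrreducibleFamily (S : Set (Matrix (Fin n) (Fin n) D)))
    (htri : ∀ A ∈ S, A.IsTriangularizable)
    (hs : ∀ A ∈ S, A.rightSpectrum ⊆ Set.range (algebraMap ℝ D)) (k : ℕ)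
    (hk : (eigenvalueSum '' (S : Set (Matrix (Fin n) (Fin n) D))).encard ≤ k) :
    (S : Set (Matrix (Fin n) (Fin n) D)).encard ≤ (k ^ n ^ 2 : ℕ) := by
  have hTfin := Set.finite_of_encard_le_coe hk
  have hfin : (S : Set (Matrix (Fin n) (Fin n) D)).Finite := by
    refine finite_of_finite_trace hn hirr ?_
    refine (hTfin.image fun r => (Module.finrank ℝ D : ℝ) * r).subset ?_
    rintro _ ⟨A, hA, rfl⟩
    exact ⟨_, ⟨A, hA, rfl⟩, (trace_realEnd_eq (htri A hA) (hs A hA)).symm⟩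
  obtain ⟨u, c, hu, hc, hE⟩ := exists_vecMulVec_mem hn hirr hfin fun A hA =>
    exists_splits_aeval_eq_zero (htri A hA) (hs A hA)
  have hEapp : ∀ x, vecMulVec u c *ᵥ x = MulOpposite.op (c ⬝ᵥ x) • u := vecMulVec_mulVec u c
  have hE0 : vecMulVec u c ≠ 0 := by
    obtain ⟨i, hi⟩ := Function.ne_iff.1 hu
    obtain ⟨j, hj⟩ := Function.ne_iff.1 hc
    exact fun h => mul_ne_zero hi hj (congrFun (congrFun h i) j)
  obtain ⟨f, hf, hfsep⟩ := exists_separating_orbit hirr hu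
  obtain ⟨B, hB, hBsep⟩ := exists_separating_rows hirr hE0
  -- The product is the rank-one matrix with column `f i *ᵥ u` and row `c ᵥ* (B j * A)`, so its
  -- eigenvalue sum is a matrix coefficient of `A`.
  let Φ : Matrix (Fin n) (Fin n) D → Fin n × Fin n → ℝ := fun A p =>
    (f p.1 * vecMulVec u c * (B p.2 * A)).eigenvalueSum
  have hmem : ∀ A ∈ S, ∀ i j, f i * vecMulVec u c * (B j * A) ∈ S := fun A hA i j =>
    S.mul_mem (S.mul_mem (hf i) hE) (S.mul_mem (hB j) hA)
  have hΦ : ∀ A ∈ S, ∀ i j, c ⬝ᵥ (B j *ᵥ (A *ᵥ (f i *ᵥ u))) = algebraMap ℝ D (Φ A (i, j)) := by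
    intro A hA i j
    have hmem' := hmem A hA i j
    have heq : f i * vecMulVec u c * (B j * A) = vecMulVec (f i *ᵥ u) (c ᵥ* (B j * A)) := by
      rw [mul_vecMulVec, vecMulVec_mul]
    have h1 := dotProduct_eq_eigenvalueSum (heq ▸ htri _ hmem') (heq ▸ hs _ hmem')
    rw [← heq, ← dotProduct_mulVec, ← mulVec_mulVec] at h1
    exact h1
  have hinj : Set.InjOn Φ (S : Set (Matrix (Fin n) (Fin n) D)) := by
    intro A hA A' hA' h
    refine hfsep _ _ fun i => ?_
    rw [← sub_eq_zero]
    refine hBsep _ fun j => ?_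
    rw [hEapp, mulVec_sub, dotProduct_sub, hΦ A hA, hΦ A' hA', h, sub_self, MulOpposite.op_zero,
      zero_smul]
  have hmaps : Set.MapsTo Φ (S : Set (Matrix (Fin n) (Fin n) D))
      (Fintype.piFinset fun _ : Fin n × Fin n => hTfin.toFinset : Finset _) := by
    intro A hA
    rw [Finset.mem_coe, Fintype.mem_piFinset]
    exact fun p => hTfin.mem_toFinset.2 ⟨_, hmem A hA p.1 p.2, rfl⟩
  refine (Set.encard_le_encard_of_injOn hmaps hinj).trans ?_
  rw [Set.encard_coe_eq_coe_finsetCard, Fintype.card_piFinset, Finset.prod_const,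
    Finset.card_univ, Fintype.card_prod, Fintype.card_fin, ← pow_two]
  rw [hTfin.encard_eq_coe_toFinset_card] at hk
  exact_mod_cast Nat.pow_le_pow_left (by exact_mod_cast hk) _

end Matrix

theorem theorem2p7 {D : Type*} [DivisionRing D] [Algebra ℝ D]
    (hD : Nonempty (D ≃ₐ[ℝ] ℝ) ∨ Nonempty (D ≃ₐ[ℝ] ℂ) ∨ Nonempty (D ≃ₐ[ℝ] ℍ[ℝ]))
    (n : ℕ) (hn : 1 < n) (F : Subfield ℝ)
    (S : Subsemigroup (Matrix (Fin n) (Fin n) D))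
    (hirr : Matrix.IsIrreducibleFamily (S : Set (Matrix (Fin n) (Fin n) D)))
    (htri : ∀ A ∈ S, A.IsTriangularizable)
    (hspec : ∀ A ∈ S, A.rightSpectrum ⊆ algebraMap ℝ D '' (F : Set ℝ))
    (k : ℕ) (hk : (Matrix.eigenvalueSum '' (S : Set (Matrix (Fin n) (Fin n) D))).encard = k) :
    (S : Set (Matrix (Fin n) (Fin n) D)).encard ≤ (k ^ n ^ 2 : ℕ) ∧ 1 < k := by
  have : FiniteDimensional ℝ D := by
    rcases hD with ⟨⟨e⟩⟩ | ⟨⟨e⟩⟩ | ⟨⟨e⟩⟩ <;> exact Module.Finite.equiv e.toLinearEquiv.symm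
  have hle := Matrix.encard_le_of_eigenvalueSum (by omega) hirr htri
    (fun A hA => (hspec A hA).trans (Set.image_subset_range _ _)) k hk.le
  refine ⟨hle, ?_⟩
  by_contra! hk1
  have h1 := (Matrix.one_lt_encard hn hirr).trans_le hle
  have h2 : 1 < k ^ n ^ 2 := by exact_mod_cast h1
  exact absurd (Nat.pow_le_pow_left hk1 (n ^ 2)) (by rw [one_pow]; omega)
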